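/- Let $N,D\ge 1$ and $K\ge K^*\ge 0$ be integers and $B,C>0$ reals. Let $L(\theta,z)$ be a real loss of a model $\theta\in\mathbb R^K$ and a data point $z\in\mathcal Z$, differentiable in $\theta$ at the current model $\theta$ for every $z$, and let $g(z)=\mathrm{clip}(\nabla_\theta L(\theta,z),C)$ be the clipped gradient, where $\mathrm{clip}(x,C)=Cx/\max(\|x\|_2,C)$. Each user $j\in\{1,\dots,N\}$ holds a dataset $D_j=(d_{j,1},\dots,d_{j,D})\in\mathcal Z^D$ and computes the update $x_j=\sum_{k=1}^D w_{j,k}\,g(d_{j,k})$ with weights $w_{j,k}=\frac1D+\frac1{\sqrt{BD}}\xi_{j,k}$, where $\xi_1,\dots,\xi_N$ are independent $\mathcal N(0,I_D)$ random vectors. The server sees only the aggregated update $x=\sum_{j=1}^N x_j$. Suppose that there is a matrix $S\in\mathbb R^{K\times K^*}$ with orthonormal columns such that for every data point $z\in\mathcal Z$ we have $g(z)=S\,g^*(z)$ for some $g^*(z)\in\mathbb R^{K^*}$. For a dataset $E=(e_1,\dots,e_D)$ let $\Sigma^*(E)=\frac1D\sum_{k=1}^D g^*(e_k)g^*(e_k)^{\mathsf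 T}$ be its projected covariance. Let $\lambda^*_{1},\dots,\lambda^*_{N}>0$ satisfy $\frac{C^2}{D}<\sum_{j=1}^N\lambda^*_{j}$. Fix a user $i$ and datasets $D_j$, $j\ne i$, of the other users such that all eigenvalues of $\Sigma^*(D_j)$ are at least $\lambda^*_{j}$. Let $\mathcal M$ be the mechanism that maps the dataset $D_i\in\mathcal Z^D$ of user $i$ to the law of $x$, and call $D_i,D_i'\in\mathcal Z^D$ adjacent if they differ in at most one data point and, for at least one of the two, all eigenvalues of the projected covariance are at least $\lambda^*_{i}$ (if every possible dataset of user $i$ satisfies this eigenvalue bound, this is just the usual adjacency). Then for every $\alpha\in\big(1,\ D\sum_{j=1}^N\lambda^*_{j}/C^2\big)$, with $$\varepsilon^*=\Big(\frac{2\alpha BC^2}{D^2}+\frac{\alpha C^2}{(\alpha-1)D}\Big)\frac{1}{\sum_{j=1}^N\lambda^*_{j}-\frac{\alpha C^2}{D}},$$ the mechanism $\mathcal M$ satisfies $(\alpha,\varepsilon^*)$-RDP, that is, $D_\alpha(\mathcal M(D_i)\,\|\,\mathcal M(D_i'))\le\varepsilon^*$ for all adjacent $D_i,D_i'$, where $D_\alpha$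 is the Rényi divergence of order $\alpha$; and for every $\delta>0$ it satisfies $\big(\varepsilon^*+\frac{\log(1/\delta)}{\alpha-1},\delta\big)$-DP, that is, $\mathcal M(D_i)(A)\le e^{\varepsilon^*+\log(1/\delta)/(\alpha-1)}\,\mathcal M(D_i')(A)+\delta$ for all adjacent $D_i,D_i'$ and all Borel sets $A\subseteq\mathbb R^K$. -/

import Mathlib

open MeasureTheory ProbabilityTheory
open scoped ENNReal

noncomputable section

namespace FedSA

/-! ### Rényi divergence, Rényi differential privacy, differential privacy -/

/-- The Rényi divergence `D_α(P ‖ Q) = (α - 1)⁻¹ log E_{x ∼ Q} [(dP/dQ (x)) ^ α]` of order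
`α ∈ (0, 1) ∪ (1, ∞)`, with values in the extended reals. The likelihood ratio `P(x) / Q(x)` is
the Radon–Nikodym derivative, so that no dominating Lebesgue density is needed; for `α > 1` the
divergence is `⊤` if `P` is not absolutely continuous with respect to `Q`. -/
def renyiDiv {Y : Type*} [MeasurableSpace Y] (α : ℝ) (P Q : Measure Y) : EReal :=
  open scoped Classical in
  if 1 < α ∧ ¬ P ≪ Q then ⊤
  else (((α - 1)⁻¹ : ℝ) : EReal) * ENNReal.log (∫⁻ x, (P.rnDeriv Q x) ^ α ∂Q)

/-- A randomized mechanism, given by the law `M x` of its output on each input `x`, satisfies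
`(α, ε)`-RDP with respect to an adjacency relation on the inputs. -/
def IsRDP {X Y : Type*} [MeasurableSpace Y] (M : X → Measure Y) (adj : X → X → Prop)
    (α ε : ℝ) : Prop :=
  ∀ x x', adj x x' → renyiDiv α (M x) (M x') ≤ (ε : EReal)

/-- A randomized mechanism, given by the law `M x` of its output on each input `x`, satisfies
`(ε, δ)`-DP with respect to an adjacency relation on the inputs. -/
def IsDP {X Y : Type*} [MeasurableSpace Y] (M : X → Measure Y) (adj : X → X → Prop)
    (ε δ : ℝ) : Prop :=
  ∀ x x', adj x x' → ∀ A : Set Y, MeasurableSet A →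
    M x A ≤ ENNReal.ofReal (Real.exp ε) * M x' A + ENNReal.ofReal δ

/-- Two local datasets of size `D` differ in (at most) one data point. -/
def DifferInOne {Z : Type*} {D : ℕ} (d d' : Fin D → Z) : Prop :=
  ∃ k : Fin D, ∀ j, j ≠ k → d j = d' j

/-! ### FedSGD with clipping and Gaussian sampling noise -/

/-- `clip(x, C) = C x / max(‖x‖₂, C)`. -/
def clip {K : ℕ} (C : ℝ) (x : EuclideanSpace ℝ (Fin K)) : EuclideanSpace ℝ (Fin K) :=
  (C / max ‖x‖ C) • x

/-- The clipped gradient at the model `θ` of the loss `L` at the data point `z`. -/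
def clippedGrad {K : ℕ} {Z : Type*} (L : EuclideanSpace ℝ (Fin K) → Z → ℝ)
    (θ : EuclideanSpace ℝ (Fin K)) (C : ℝ) (z : Z) : EuclideanSpace ℝ (Fin K) :=
  clip C (gradient (fun θ' => L θ' z) θ)

/-- The sampling weights `w = 1/D + ξ / √(B D)` built from the noise vector `ξ`. -/
def samplingWeight {D : ℕ} (B : ℝ) (ξ : EuclideanSpace ℝ (Fin D)) (k : Fin D) : ℝ :=
  1 / (D : ℝ) + 1 / Real.sqrt (B * D) * ξ k

/-- The local model update `x = G w = ∑ₖ wₖ gₖ` of a user with dataset `d`. -/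
def localUpdate {K D : ℕ} {Z : Type*} (L : EuclideanSpace ℝ (Fin K) → Z → ℝ)
    (θ : EuclideanSpace ℝ (Fin K)) (C B : ℝ) (d : Fin D → Z) (ξ : EuclideanSpace ℝ (Fin D)) :
    EuclideanSpace ℝ (Fin K) :=
  ∑ k, samplingWeight B ξ k • clippedGrad L θ C (d k)

/-- The law of the aggregated model update `∑ⱼ Gⱼ wⱼ` of `N` users with datasets `data j` and
sampling noise `ξ j`. -/
def aggregateLaw {N K D : ℕ} {Z Ω : Type*} [MeasurableSpace Ω] (P : Measure Ω)
    (ξ : Fin N → Ω → EuclideanSpace ℝ (Fin D)) (L : EuclideanSpace ℝ (Fin K) → Z → ℝ)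
    (θ : EuclideanSpace ℝ (Fin K)) (C B : ℝ) (data : Fin N → Fin D → Z) :
    Measure (EuclideanSpace ℝ (Fin K)) :=
  P.map (fun ω => ∑ j, localUpdate L θ C B (data j) (ξ j ω))

/-- The aggregated model update as a mechanism acting on the dataset of user `i`, the datasets
of the other users being fixed (the entry `data i` is not used). -/
def userMechanism {N K D : ℕ} {Z Ω : Type*} [MeasurableSpace Ω] (P : Measure Ω)
    (ξ : Fin N → Ω → EuclideanSpace ℝ (Fin D)) (L : EuclideanSpace ℝ (Fin K) → Z → ℝ)
    (θ : EuclideanSpace ℝ (Fin K)) (C B : ℝ) (data : Fin N → Fin D → Z) (i : Fin N) :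
    (Fin D → Z) → Measure (EuclideanSpace ℝ (Fin K)) :=
  fun d => aggregateLaw P ξ L θ C B (Function.update data i d)

/-! ### Covariance in the subspace -/

/-- The projected covariance `Σ* = (1/D) ∑ₖ g*ₖ (g*ₖ)ᵀ` of the gradient noise of a user with
dataset `d`, where `gs z` is the coordinate vector in the subspace of the gradient at `z`. -/
def projCov {Ks D : ℕ} {Z : Type*} (gs : Z → Fin Ks → ℝ) (d : Fin D → Z) :
    Matrix (Fin Ks) (Fin Ks) ℝ :=
  (1 / (D : ℝ)) • ∑ k, Matrix.vecMulVec (gs (d k)) (gs (d k))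

/-- All eigenvalues of the real square matrix `A` are at least `l`. -/
def MinEigenvalueGE {n : ℕ} (A : Matrix (Fin n) (Fin n) ℝ) (l : ℝ) : Prop :=
  ∀ μ : ℝ, Module.End.HasEigenvalue (Matrix.toLin' A) μ → l ≤ μ

/-- Adjacency of datasets of one user: they differ in one data point, and at least one of the two
has a projected covariance whose eigenvalues are all at least `l`. On a domain all of whose
datasets satisfy this eigenvalue bound, this is plain adjacency. -/
def Neighbor {Ks D : ℕ} {Z : Type*} (gs : Z → Fin Ks → ℝ) (l : ℝ) (d d' : Fin D → Z) : Prop :=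
  DifferInOne d d' ∧ (MinEigenvalueGE (projCov gs d) l ∨ MinEigenvalueGE (projCov gs d') l)

/-- The privacy parameter
`(2 α B C² / D² + α C² / ((α - 1) D)) · 1 / (Λ - α C² / D)`. -/
def epsStar (α B C D Λ : ℝ) : ℝ :=
  (2 * α * B * C ^ 2 / D ^ 2 + α * C ^ 2 / ((α - 1) * D)) * (1 / (Λ - α * C ^ 2 / D))

end FedSA

end

/-!
The Rényi divergence is handled through its dual (Hölder) form `RenyiPowerLE α R P Q`, which says
that `∫ k ^ (α - 1) dP ≤ R ^ (1 / α) (∫ k ^ α dQ) ^ ((α - 1) / α)` for every nonnegative measurable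
`k`. For finite measures this forces `P ≪ Q` and bounds `∫ (dP/dQ) ^ α dQ` by `R`, and so it yields
both the divergence bound (`RenyiPowerLE.renyiDiv_le`) and, by a Markov-type estimate on the
likelihood ratio, the approximate differential privacy bound (`RenyiPowerLE.measure_le_add`). Its
advantage is that it passes to images under measurable maps (`RenyiPowerLE.map`) with no computation
of densities, and that `Q` may be replaced by a smaller measure (`RenyiPowerLE.of_smul_le`).

Let `q₀` be the index of the data point in which the two datasets of the user differ, and let `u`
and `v` be its projected clipped gradients in the two cases. Up to the common isometry `S`, the
aggregate is an affine image `Θ η + (s + t ζ) u`, respectively `Θ η + (s + t ζ) v`, where `η` is the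
standard Gaussian noise of all other data points, `ζ` is an independent standard Gaussian variable,
`s = 1 / D` and `t = 1 / √(B D)` (`map_sum_noise_eq`). If one of the two datasets satisfies the
eigenvalue bound, then dropping the term of `q₀` from the sum of all `g* (g*)ᵀ` leaves a matrix which
is at least `m = D Λ - C ^ 2`, where `Λ` is the sum of the eigenvalue bounds; so the linear part of
`Θ` has a right inverse of norm at most `1 / (t √m)` (`LinearMap.exists_rightInverse_adjoint`). Hence
`u` and `v` lift to vectors `U`, `V` of noise space, and both laws are images under `Θ` of the laws
of `η + (s + t ζ) U` and `η + (s + t ζ) V`.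

For these it is enough to compare with the centre of the second law, because the law of
`η + (s + t ζ) V` is at least `exp (- t² ‖V‖² / 2)` times the law of `η + s V`
(`smul_stdGaussian_le_map`). What remains is the moment of order `α` of an explicit density with
respect to a standard Gaussian measure. It is computed with one-dimensional Gaussian integrals and
the shift formula `stdGaussian_map_add_const` (`lintegral_density_rpow_le`), and elementary estimates
turn the outcome into `epsStar` (`renyi_exponent_le`).
-/

open scoped RealInnerProductSpace

/-! ### The dual form of Rényi divergence bounds -/

/-- The moment `∫ (dP/dQ) ^ α dQ` is at most `R`, in dual form: Hölder's inequality with exponents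
`α` and `α / (α - 1)` holds for `∫ k ^ (α - 1) dP` as if the likelihood ratio had `α`-th moment `R`.
The test functions are written as powers `k ^ (α - 1)`, so that the conjugate norm is an integral of
`k ^ α`. No density appears, and absolute continuity is a consequence. -/
def RenyiPowerLE {Y : Type*} [MeasurableSpace Y] (α : ℝ) (R : ℝ≥0∞) (P Q : Measure Y) : Prop :=
  ∀ k : Y → ℝ≥0∞, Measurable k →
    ∫⁻ y, k y ^ (α - 1) ∂P ≤ R ^ (1 / α) * (∫⁻ y, k y ^ α ∂Q) ^ ((α - 1) / α)

namespace RenyiPowerLE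

variable {Y Y' : Type*} [MeasurableSpace Y] [MeasurableSpace Y'] {α : ℝ} {R R' : ℝ≥0∞}
  {P Q Q' : Measure Y}

theorem mono_const (hα : 1 < α) (h : RenyiPowerLE α R P Q) (hR : R ≤ R') :
    RenyiPowerLE α R' P Q := by
  intro k hk
  refine (h k hk).trans ?_
  gcongr

/-- The data processing inequality. -/
theorem map (h : RenyiPowerLE α R P Q) {f : Y → Y'} (hf : Measurable f) :
    RenyiPowerLE α R (P.map f) (Q.map f) := by
  intro k hk
  rw [lintegral_map (by fun_prop) hf, lintegral_map (by fun_prop) hf]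
  exact h (fun y => k (f y)) (hk.comp hf)

theorem of_withDensity (hα : 1 < α) {p : Y → ℝ≥0∞} (hp : Measurable p) :
    RenyiPowerLE α (∫⁻ y, p y ^ α ∂Q) (Q.withDensity p) Q := by
  intro k hk
  have hα0 : 0 < α := by linarith
  have hconj : α.HolderConjugate (α / (α - 1)) := Real.HolderConjugate.conjExponent hα
  rw [lintegral_withDensity_eq_lintegral_mul _ hp (by fun_prop)]
  refine (ENNReal.lintegral_mul_le_Lp_mul_Lq Q hconj hp.aemeasurable
    (g := fun y => k y ^ (α - 1)) (by fun_prop)).trans (le_of_eq ?_)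
  have h1 : (α - 1) * (α / (α - 1)) = α := by
    field_simp [(by linarith : α - 1 ≠ 0)]
  simp only [← ENNReal.rpow_mul, h1, one_div_div]

/-- A lower bound `c • Q' ≤ Q` costs a factor `c ^ (1 - α)` in the moment. -/
theorem of_smul_le (hα : 1 < α) (h : RenyiPowerLE α R P Q') {c : ℝ≥0∞} (hc0 : c ≠ 0) (hc : c ≠ ⊤)
    (hQ : c • Q' ≤ Q) : RenyiPowerLE α (c⁻¹ ^ (α - 1) * R) P Q := by
  intro k hk
  have hα0 : 0 < α := by linarith
  refine (h k hk).trans ?_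
  have h1 : ∫⁻ y, k y ^ α ∂Q' ≤ c⁻¹ * ∫⁻ y, k y ^ α ∂Q := by
    have h2 : c * ∫⁻ y, k y ^ α ∂Q' ≤ ∫⁻ y, k y ^ α ∂Q := by
      rw [← smul_eq_mul, ← lintegral_smul_measure]
      exact lintegral_mono' hQ le_rfl
    calc ∫⁻ y, k y ^ α ∂Q' = c⁻¹ * (c * ∫⁻ y, k y ^ α ∂Q') := by
          rw [← mul_assoc, ENNReal.inv_mul_cancel hc0 hc, one_mul]
      _ ≤ _ := by gcongr
  calc R ^ (1 / α) * (∫⁻ y, k y ^ α ∂Q') ^ ((α - 1) / α)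
      ≤ R ^ (1 / α) * (c⁻¹ * ∫⁻ y, k y ^ α ∂Q) ^ ((α - 1) / α) := by
        gcongr
    _ = _ := by
        rw [ENNReal.mul_rpow_of_nonneg _ _ (div_nonneg (by linarith) hα0.le),
          ENNReal.mul_rpow_of_nonneg _ _ (by positivity : 0 ≤ 1 / α), ← ENNReal.rpow_mul,
          mul_one_div]
        ring

theorem absolutelyContinuous (hα : 1 < α) (h : RenyiPowerLE α R P Q) : P ≪ Q := by
  refine Measure.AbsolutelyContinuous.mk fun A hA hQA => ?_
  have hα0 : 0 < α := by linarith
  have h1 := h (A.indicator 1) (measurable_one.indicator hA)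
  have key : ∀ β : ℝ, 0 < β → ∀ ν : Measure Y,
      ∫⁻ y, (A.indicator (1 : Y → ℝ≥0∞) y) ^ β ∂ν = ν A := by
    intro β hβ ν
    rw [← lintegral_indicator_one hA]
    congr 1 with y
    by_cases hy : y ∈ A <;> simp [hy, hβ]
  rw [key _ (by linarith), key _ hα0, hQA,
    ENNReal.zero_rpow_of_pos (div_pos (by linarith) hα0), mul_zero] at h1
  exact le_antisymm h1 (zero_le)

/-- Duality: testing with the likelihood ratio itself gives the bound on its moment. The ratio is
truncated so that the power of the integral can be cancelled. -/
theorem lintegral_rnDeriv_rpow_le [IsFiniteMeasure P] [IsFiniteMeasure Q] (hα : 1 < α)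
    (h : RenyiPowerLE α R P Q) : ∫⁻ y, P.rnDeriv Q y ^ α ∂Q ≤ R := by
  have hα0 : 0 < α := by linarith
  have hac := h.absolutelyContinuous hα
  set r := P.rnDeriv Q with hr
  have hrm : Measurable r := Measure.measurable_rnDeriv P Q
  have hP : P = Q.withDensity r := (Measure.withDensity_rnDeriv_eq P Q hac).symm
  have step : ∀ n : ℕ, ∫⁻ y, (min (r y) n) ^ α ∂Q ≤ R := by
    intro n
    set I := ∫⁻ y, (min (r y) n) ^ α ∂Q with hI
    have hItop : I ≠ ⊤ := by
      refine ne_of_lt (lt_of_le_of_lt (lintegral_mono (g := fun _ => (n : ℝ≥0∞) ^ α)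
        fun y => ENNReal.rpow_le_rpow (min_le_right _ _) hα0.le) ?_)
      rw [lintegral_const]
      exact ENNReal.mul_lt_top (ENNReal.rpow_lt_top_of_nonneg hα0.le (by simp))
        (measure_lt_top _ _)
    have h1 : I ≤ R ^ (1 / α) * I ^ ((α - 1) / α) := by
      refine le_trans ?_ (h (fun y => min (r y) n) (by fun_prop))
      conv_rhs => rw [hP]
      rw [lintegral_withDensity_eq_lintegral_mul _ hrm (by fun_prop)]
      refine lintegral_mono fun y => ?_
      have h2 : (min (r y) (n : ℝ≥0∞)) ^ α
          = min (r y) (n : ℝ≥0∞) * (min (r y) (n : ℝ≥0∞)) ^ (α - 1) := by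
        conv_lhs => rw [show α = 1 + (α - 1) by ring]
        rw [ENNReal.rpow_add_of_nonneg _ _ zero_le_one (by linarith), ENNReal.rpow_one]
      simp only [Pi.mul_apply]
      rw [h2]
      gcongr
      exact min_le_left _ _
    rcases eq_or_ne I 0 with h0 | h0
    · simp [h0]
    have h3 : I = I ^ (1 / α) * I ^ ((α - 1) / α) := by
      rw [← ENNReal.rpow_add _ _ h0 hItop]
      rw [show 1 / α + (α - 1) / α = 1 by field_simp; ring, ENNReal.rpow_one]
    have h4 : I ^ (1 / α) ≤ R ^ (1 / α) := by
      have h5 : I ^ (1 / α) * I ^ ((α - 1) / α) ≤ R ^ (1 / α) * I ^ ((α - 1) / α) := by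
        rw [← h3]; exact h1
      refine (ENNReal.mul_le_mul_iff_left ?_ ?_).1 h5
      · exact (ENNReal.rpow_pos (pos_iff_ne_zero.2 h0) hItop).ne'
      · exact ENNReal.rpow_ne_top_of_nonneg (div_nonneg (by linarith) hα0.le) hItop
    exact (ENNReal.rpow_le_rpow_iff (by positivity)).1 h4
  have hsup : ∀ y, r y ^ α = ⨆ n : ℕ, (min (r y) n) ^ α := by
    intro y
    have : r y = ⨆ n : ℕ, min (r y) n := by
      rw [← inf_iSup_eq, ENNReal.iSup_natCast, inf_top_eq]
    conv_lhs => rw [this]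
    exact (ENNReal.orderIsoRpow α hα0).map_iSup _
  simp_rw [hsup]
  rw [lintegral_iSup (fun n => by fun_prop)]
  · exact iSup_le step
  · intro n m hnm y
    dsimp only
    gcongr

theorem renyiDiv_le [IsFiniteMeasure P] [IsFiniteMeasure Q] (hα : 1 < α) {ε : ℝ}
    (h : RenyiPowerLE α (ENNReal.ofReal (Real.exp ((α - 1) * ε))) P Q) :
    FedSA.renyiDiv α P Q ≤ (ε : EReal) := by
  have hα1 : 0 < α - 1 := by linarith
  rw [FedSA.renyiDiv, if_neg (by simp [h.absolutelyContinuous hα])]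
  have h1 : ENNReal.log (∫⁻ y, P.rnDeriv Q y ^ α ∂Q) ≤ (((α - 1) * ε : ℝ) : EReal) := by
    refine (ENNReal.log_monotone (h.lintegral_rnDeriv_rpow_le hα)).trans (le_of_eq ?_)
    rw [ENNReal.log_ofReal_of_pos (Real.exp_pos _), Real.log_exp]
  calc _ ≤ (((α - 1)⁻¹ : ℝ) : EReal) * (((α - 1) * ε : ℝ) : EReal) :=
        mul_le_mul_of_nonneg_left h1 (by exact_mod_cast (inv_pos.2 hα1).le)
    _ = _ := by
        rw [← EReal.coe_mul]
        congr 1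
        field_simp

/-- The conversion of a Rényi divergence bound into approximate differential privacy. -/
theorem measure_le_add [IsFiniteMeasure P] [IsFiniteMeasure Q] (hα : 1 < α) {ε δ : ℝ} (hδ : 0 < δ)
    (h : RenyiPowerLE α (ENNReal.ofReal (Real.exp ((α - 1) * ε))) P Q)
    {A : Set Y} (hA : MeasurableSet A) :
    P A ≤ ENNReal.ofReal (Real.exp (ε + Real.log (1 / δ) / (α - 1))) * Q A
      + ENNReal.ofReal δ := by
  have hα1 : 0 < α - 1 := by linarith
  have hac := h.absolutelyContinuous hα
  have hle := h.lintegral_rnDeriv_rpow_le hα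
  set r := P.rnDeriv Q with hr
  have hrm : Measurable r := Measure.measurable_rnDeriv P Q
  have hP : P = Q.withDensity r := (Measure.withDensity_rnDeriv_eq P Q hac).symm
  set t := Real.exp (ε + Real.log (1 / δ) / (α - 1)) with ht
  have ht0 : 0 < t := Real.exp_pos _
  set T := ENNReal.ofReal t
  have hT0 : T ≠ 0 := by simpa [T] using ht0
  have hTtop : T ≠ ⊤ := ENNReal.ofReal_ne_top
  -- on the set where the likelihood ratio exceeds `T`, it is at most `T ^ (1 - α) * r ^ α`
  have hpt : ∀ y, r y ≤ T + (T ^ (α - 1))⁻¹ * r y ^ α := by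
    intro y
    rcases le_total (r y) T with hy | hy
    · exact hy.trans le_self_add
    · refine le_trans ?_ le_add_self
      have h2 : r y ^ α = r y ^ (α - 1) * r y := by
        conv_lhs => rw [show α = (α - 1) + 1 by ring]
        rw [ENNReal.rpow_add_of_nonneg _ _ hα1.le zero_le_one, ENNReal.rpow_one]
      rw [h2, ← mul_assoc]
      refine le_mul_of_one_le_left (zero_le) ?_
      rw [← ENNReal.inv_mul_cancel (a := T ^ (α - 1))
        (ENNReal.rpow_pos (pos_iff_ne_zero.2 hT0) hTtop).ne'
        (ENNReal.rpow_ne_top_of_nonneg hα1.le hTtop)]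
      gcongr
  calc P A = ∫⁻ y in A, r y ∂Q := by rw [hP, withDensity_apply _ hA]
    _ ≤ ∫⁻ y in A, (T + (T ^ (α - 1))⁻¹ * r y ^ α) ∂Q := lintegral_mono hpt
    _ = T * Q A + (T ^ (α - 1))⁻¹ * ∫⁻ y in A, r y ^ α ∂Q := by
        rw [lintegral_add_left measurable_const, lintegral_const, lintegral_const_mul _ (by fun_prop),
          Measure.restrict_apply_univ]
    _ ≤ T * Q A + (T ^ (α - 1))⁻¹ * ENNReal.ofReal (Real.exp ((α - 1) * ε)) := by
        gcongr
        exact (setLIntegral_le_lintegral _ _).trans hle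
    _ = T * Q A + ENNReal.ofReal δ := by
        congr 1
        rw [ENNReal.ofReal_rpow_of_pos ht0, ← ENNReal.ofReal_inv_of_pos (by positivity),
          ← ENNReal.ofReal_mul (by positivity), ht, ← Real.exp_mul, ← Real.exp_neg, ← Real.exp_add]
        congr 1
        rw [show -((ε + Real.log (1 / δ) / (α - 1)) * (α - 1)) + (α - 1) * ε = Real.log δ by
          rw [one_div, Real.log_inv]; field_simp; ring, Real.exp_log hδ]

end RenyiPowerLE

/-! ### Shifts of the standard Gaussian measure -/

section Gaussian

theorem lintegral_exp_quadratic_gaussianReal {A : ℝ} (hA : -1 < A) (B : ℝ) :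
    ∫⁻ z, ENNReal.ofReal (Real.exp (B * z - A * z ^ 2 / 2)) ∂gaussianReal 0 1 =
      ENNReal.ofReal ((√(1 + A))⁻¹ * Real.exp (B ^ 2 / (2 * (1 + A)))) := by
  have hA1 : 0 < 1 + A := by linarith
  set v : NNReal := ⟨(1 + A)⁻¹, (inv_pos.2 hA1).le⟩ with hv
  have hvr : (v : ℝ) = (1 + A)⁻¹ := rfl
  have hv0 : v ≠ 0 := by
    intro h
    have : (v : ℝ) = 0 := by rw [h]; rfl
    rw [hvr] at this
    exact (inv_pos.2 hA1).ne' this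
  rw [gaussianReal_of_var_ne_zero _ one_ne_zero,
    lintegral_withDensity_eq_lintegral_mul _ (measurable_gaussianPDF _ _) (by fun_prop)]
  have hpt : ∀ z, (gaussianPDF 0 1 * fun z => ENNReal.ofReal (Real.exp (B * z - A * z ^ 2 / 2))) z =
      ENNReal.ofReal ((√(1 + A))⁻¹ * Real.exp (B ^ 2 / (2 * (1 + A)))) *
        gaussianPDF (B / (1 + A)) v z := by
    intro z
    simp only [Pi.mul_apply, gaussianPDF]
    rw [← ENNReal.ofReal_mul (gaussianPDFReal_nonneg _ _ _), ← ENNReal.ofReal_mul (by positivity)]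
    congr 1
    simp only [gaussianPDFReal, hvr, NNReal.coe_one]
    have hs : √(2 * Real.pi * (1 + A)⁻¹) = √(2 * Real.pi) * (√(1 + A))⁻¹ := by
      rw [Real.sqrt_mul (by positivity), Real.sqrt_inv]
    have hne : √(1 + A) ≠ 0 := (Real.sqrt_pos.2 hA1).ne'
    have hne2 : √(2 * Real.pi) ≠ 0 := (Real.sqrt_pos.2 (by positivity)).ne'
    rw [hs, mul_one]
    rw [mul_assoc, ← Real.exp_add]
    rw [show (√(1 + A))⁻¹ * Real.exp (B ^ 2 / (2 * (1 + A))) * ((√(2 * Real.pi) * (√(1 + A))⁻¹)⁻¹ *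
      Real.exp (-(z - B / (1 + A)) ^ 2 / (2 * (1 + A)⁻¹))) = (√(2 * Real.pi))⁻¹ *
      (Real.exp (B ^ 2 / (2 * (1 + A))) * Real.exp (-(z - B / (1 + A)) ^ 2 / (2 * (1 + A)⁻¹))) by
        field_simp]
    rw [← Real.exp_add]
    congr 2
    field_simp
    ring
  rw [lintegral_congr hpt, lintegral_const_mul _ (measurable_gaussianPDF _ _),
    lintegral_gaussianPDF_eq_one _ hv0, mul_one]

theorem lintegral_prod_pi {ι : Type*} [Fintype ι] {X : ι → Type*} [∀ i, MeasurableSpace (X i)]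
    (μ : ∀ i, Measure (X i)) [∀ i, IsProbabilityMeasure (μ i)] {f : ∀ i, X i → ℝ≥0∞}
    (hf : ∀ i, Measurable (f i)) :
    ∫⁻ x, ∏ i, f i (x i) ∂Measure.pi μ = ∏ i, ∫⁻ y, f i y ∂μ i := by
  have hind : iIndepFun (fun i (x : ∀ i, X i) => f i (x i)) (Measure.pi μ) :=
    (iIndepFun_pi (X := fun i => f i) fun i => (hf i).aemeasurable)
  rw [lintegral_prod_eq_prod_lintegral_of_indepFun Finset.univ _ hind
    (fun i => (hf i).comp (measurable_pi_apply i))]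
  refine Finset.prod_congr rfl fun i _ => ?_
  exact (measurePreserving_eval μ i).lintegral_comp (hf i)

theorem pi_withDensity_prod {ι : Type*} [Fintype ι] {X : ι → Type*} [∀ i, MeasurableSpace (X i)]
    (μ : ∀ i, Measure (X i)) [∀ i, IsProbabilityMeasure (μ i)] {f : ∀ i, X i → ℝ≥0∞}
    (hf : ∀ i, Measurable (f i)) [∀ i, SigmaFinite ((μ i).withDensity (f i))] :
    Measure.pi (fun i => (μ i).withDensity (f i)) =
      (Measure.pi μ).withDensity fun x => ∏ i, f i (x i) := by
  refine Measure.pi_eq fun s hs => ?_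
  rw [withDensity_apply _ (MeasurableSet.univ_pi hs), ← lintegral_indicator (MeasurableSet.univ_pi hs)]
  have : ∀ x, (Set.univ.pi s).indicator (fun x => ∏ i, f i (x i)) x =
      ∏ i, (s i).indicator (f i) (x i) := by
    intro x
    by_cases hx : x ∈ Set.univ.pi s
    · rw [Set.indicator_of_mem hx]
      refine Finset.prod_congr rfl fun i _ => ?_
      rw [Set.indicator_of_mem (hx i (Set.mem_univ i))]
    · rw [Set.indicator_of_notMem hx]
      simp only [Set.mem_univ_pi, not_forall] at hx
      obtain ⟨i, hi⟩ := hx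
      rw [Finset.prod_eq_zero (Finset.mem_univ i)]
      rw [Set.indicator_of_notMem hi]
  rw [lintegral_congr this, lintegral_prod_pi μ fun i => (hf i).indicator (hs i)]
  refine Finset.prod_congr rfl fun i _ => ?_
  rw [lintegral_indicator (hs i), withDensity_apply _ (hs i)]

theorem gaussianReal_eq_withDensity_shift (h : ℝ) :
    gaussianReal h 1 = (gaussianReal 0 1).withDensity
      fun x => ENNReal.ofReal (Real.exp (x * h - h ^ 2 / 2)) := by
  rw [gaussianReal_of_var_ne_zero _ one_ne_zero, gaussianReal_of_var_ne_zero _ one_ne_zero,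
    ← withDensity_mul _ (measurable_gaussianPDF _ _) (by fun_prop)]
  congr 1 with x
  simp only [Pi.mul_apply, gaussianPDF]
  rw [← ENNReal.ofReal_mul (gaussianPDFReal_nonneg _ _ _)]
  simp only [gaussianPDFReal]
  rw [mul_assoc (√_)⁻¹, ← Real.exp_add]
  congr 4
  simp
  ring

variable {ι : Type*} [Fintype ι]

/-- The Cameron–Martin formula in finite dimension. -/
theorem stdGaussian_map_add_const (h : EuclideanSpace ℝ ι) :
    (stdGaussian (EuclideanSpace ℝ ι)).map (· + h) =
      (stdGaussian (EuclideanSpace ℝ ι)).withDensity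
        fun x => ENNReal.ofReal (Real.exp (⟪x, h⟫ - ‖h‖ ^ 2 / 2)) := by
  have h1 : (Measure.pi fun _ : ι => gaussianReal 0 1).map (fun x i => x i + h i) =
      (Measure.pi fun _ : ι => gaussianReal 0 1).withDensity
        fun x => ∏ i, ENNReal.ofReal (Real.exp (x i * h i - h i ^ 2 / 2)) := by
    have h2 : ∀ i, gaussianReal (h i) 1 = (gaussianReal 0 1).map (· + h i) := fun i => by
      rw [gaussianReal_map_add_const, zero_add]
    have h3 : ∀ i, IsProbabilityMeasure ((gaussianReal 0 1).withDensity
        fun x => ENNReal.ofReal (Real.exp (x * h i - h i ^ 2 / 2))) := fun i => by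
      rw [← gaussianReal_eq_withDensity_shift]; infer_instance
    rw [← pi_withDensity_prod (f := fun i x => ENNReal.ofReal (Real.exp (x * h i - h i ^ 2 / 2)))
      _ (fun i => by fun_prop)]
    simp_rw [← gaussianReal_eq_withDensity_shift, h2]
    exact (Measure.pi_map_pi (f := fun i x => x + h i) (μ := fun _ => gaussianReal 0 1)
      fun i => by fun_prop).symm ▸ rfl
  have hm : Measurable (WithLp.toLp 2 : (ι → ℝ) → EuclideanSpace ℝ ι) := by fun_prop
  rw [← map_pi_eq_stdGaussian, Measure.map_map (by fun_prop) hm]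
  have h4 : (fun x : EuclideanSpace ℝ ι => x + h) ∘ (WithLp.toLp 2 : (ι → ℝ) → EuclideanSpace ℝ ι) =
      (WithLp.toLp 2) ∘ (fun x i => x i + h i) := by
    ext x i; simp
  rw [h4, ← Measure.map_map hm (by fun_prop), h1]
  ext A hA
  rw [Measure.map_apply hm hA, withDensity_apply _ (hm hA), withDensity_apply _ hA,
    setLIntegral_map hA (by fun_prop) hm]
  refine lintegral_congr fun x => ?_
  rw [← ENNReal.ofReal_prod_of_nonneg (fun i _ => (Real.exp_pos _).le), ← Real.exp_sum]
  congr 2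
  rw [EuclideanSpace.real_norm_sq_eq, PiLp.inner_apply, Finset.sum_sub_distrib, Finset.sum_div]
  simp [mul_comm]

/-- The Laplace transform, read off from the total mass of the shifted measure. -/
theorem lintegral_exp_inner_stdGaussian (h : EuclideanSpace ℝ ι) :
    ∫⁻ x, ENNReal.ofReal (Real.exp ⟪x, h⟫) ∂stdGaussian (EuclideanSpace ℝ ι) =
      ENNReal.ofReal (Real.exp (‖h‖ ^ 2 / 2)) := by
  have h1 : (stdGaussian (EuclideanSpace ℝ ι)).map (· + h) Set.univ = 1 := by
    rw [Measure.map_apply (by fun_prop) MeasurableSet.univ]; simp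
  rw [stdGaussian_map_add_const, withDensity_apply _ MeasurableSet.univ, setLIntegral_univ] at h1
  have h2 : ∀ x : EuclideanSpace ℝ ι, ENNReal.ofReal (Real.exp ⟪x, h⟫) =
      ENNReal.ofReal (Real.exp (‖h‖ ^ 2 / 2)) *
        ENNReal.ofReal (Real.exp (⟪x, h⟫ - ‖h‖ ^ 2 / 2)) := by
    intro x
    rw [← ENNReal.ofReal_mul (Real.exp_pos _).le, ← Real.exp_add]
    congr 2; ring
  rw [lintegral_congr h2, lintegral_const_mul _ (by fun_prop), h1, mul_one]

/-- A mixture of shifts of the standard Gaussian measure has the mixture of the shift densities as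
its density. -/
theorem map_add_stdGaussian_prod {X : Type*} [MeasurableSpace X] (ν : Measure X) [SFinite ν]
    {H : X → EuclideanSpace ℝ ι} (hH : Measurable H) :
    ((stdGaussian (EuclideanSpace ℝ ι)).prod ν).map (fun p => p.1 + H p.2) =
      (stdGaussian (EuclideanSpace ℝ ι)).withDensity
        fun x => ∫⁻ z, ENNReal.ofReal (Real.exp (⟪x, H z⟫ - ‖H z‖ ^ 2 / 2)) ∂ν := by
  ext A hA
  have hm : Measurable fun p : EuclideanSpace ℝ ι × X => p.1 + H p.2 := by fun_prop
  rw [Measure.map_apply hm hA, Measure.prod_apply_symm (hm hA), withDensity_apply _ hA]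
  have h1 : ∀ z, stdGaussian (EuclideanSpace ℝ ι)
      ((fun x => (x, z)) ⁻¹' ((fun p : EuclideanSpace ℝ ι × X => p.1 + H p.2) ⁻¹' A)) =
      ∫⁻ x in A, ENNReal.ofReal (Real.exp (⟪x, H z⟫ - ‖H z‖ ^ 2 / 2))
        ∂stdGaussian (EuclideanSpace ℝ ι) := by
    intro z
    rw [← withDensity_apply _ hA, ← stdGaussian_map_add_const, Measure.map_apply (by fun_prop) hA]
    rfl
  rw [lintegral_congr h1, lintegral_lintegral_swap]
  exact Measurable.aemeasurable (by fun_prop)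

/-! ### Gaussian laws with a random multiple of a vector added -/

/-- The density of `η + w + t ζ u` with respect to the standard Gaussian measure in closed form. -/
theorem lintegral_exp_affine_gaussianReal (t : ℝ) (w u x : EuclideanSpace ℝ ι) :
    ∫⁻ z, ENNReal.ofReal (Real.exp (⟪x, w + (t * z) • u⟫ - ‖w + (t * z) • u‖ ^ 2 / 2))
        ∂gaussianReal 0 1 =
      ENNReal.ofReal (Real.exp (⟪x, w⟫ - ‖w‖ ^ 2 / 2) * ((√(1 + t ^ 2 * ‖u‖ ^ 2))⁻¹ *
        Real.exp ((t * ⟪x - w, u⟫) ^ 2 / (2 * (1 + t ^ 2 * ‖u‖ ^ 2))))) := by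
  have h1 : ∀ z : ℝ,
      ENNReal.ofReal (Real.exp (⟪x, w + (t * z) • u⟫ - ‖w + (t * z) • u‖ ^ 2 / 2)) =
      ENNReal.ofReal (Real.exp (⟪x, w⟫ - ‖w‖ ^ 2 / 2)) * ENNReal.ofReal
        (Real.exp ((t * ⟪x - w, u⟫) * z - (t ^ 2 * ‖u‖ ^ 2) * z ^ 2 / 2)) := by
    intro z
    rw [← ENNReal.ofReal_mul (Real.exp_pos _).le, ← Real.exp_add]
    congr 2
    rw [norm_add_sq_real, inner_add_right, inner_smul_right, inner_smul_right, norm_smul,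
      inner_sub_left, mul_pow, Real.norm_eq_abs, sq_abs]
    ring
  rw [lintegral_congr h1, lintegral_const_mul _ (by fun_prop),
    lintegral_exp_quadratic_gaussianReal (by nlinarith [mul_nonneg (sq_nonneg t) (sq_nonneg ‖u‖)]),
    ← ENNReal.ofReal_mul (Real.exp_pos _).le]

/-- Adding an independent centred Gaussian multiple of `v` to a standard Gaussian vector decreases
the measure of any set by at most the factor `exp (- t² ‖v‖² / 2)`: the density of the sum is
`(1 + t² ‖v‖²) ^ (-1/2)` times the exponential of a nonnegative quadratic form. -/
theorem smul_stdGaussian_le_map (t : ℝ) (v : EuclideanSpace ℝ ι) :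
    ENNReal.ofReal (Real.exp (-(t ^ 2 * ‖v‖ ^ 2 / 2))) • stdGaussian (EuclideanSpace ℝ ι) ≤
      ((stdGaussian (EuclideanSpace ℝ ι)).prod (gaussianReal 0 1)).map
        (fun p => p.1 + (t * p.2) • v) := by
  rw [map_add_stdGaussian_prod (gaussianReal 0 1) (H := fun z => (t * z) • v) (by fun_prop),
    ← withDensity_const]
  refine withDensity_mono (ae_of_all _ fun x => ?_)
  have h := lintegral_exp_affine_gaussianReal t 0 v x
  simp only [zero_add, inner_zero_right, norm_zero, sub_zero] at h
  dsimp only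
  rw [h]
  refine ENNReal.ofReal_le_ofReal ?_
  set b := t ^ 2 * ‖v‖ ^ 2
  have hb : 0 ≤ b := by positivity
  have h1 : √(1 + b) ≤ Real.exp (b / 2) := by
    rw [Real.exp_half]
    exact Real.sqrt_le_sqrt (by linarith [Real.add_one_le_exp b])
  have h2 : Real.exp (-(b / 2)) ≤ (√(1 + b))⁻¹ := by
    rw [Real.exp_neg]
    gcongr
  calc Real.exp (-(b / 2)) ≤ (√(1 + b))⁻¹ := h2
    _ ≤ (√(1 + b))⁻¹ * Real.exp ((t * ⟪x, v⟫) ^ 2 / (2 * (1 + b))) :=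
        le_mul_of_one_le_right (by positivity) (Real.one_le_exp (by positivity))
    _ = _ := by simp

theorem inv_sqrt_one_sub_le {x : ℝ} (hx : x < 1) :
    (√(1 - x))⁻¹ ≤ Real.exp (x / (1 - x) / 2) := by
  have h : 0 < 1 - x := by linarith
  rw [← Real.sqrt_inv, Real.exp_half]
  refine Real.sqrt_le_sqrt ?_
  refine le_trans (le_of_eq ?_) (Real.add_one_le_exp _)
  field_simp
  ring

/-- The moment of order `α` of the density of `η + w + t ζ u` with respect to the law of `η`. It is
finite only if `(α - 1) t² ‖u‖² < 1`, the positivity of the interpolated covariance. -/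
theorem lintegral_density_rpow_le {α : ℝ} (hα : 1 < α) (t : ℝ) (w u : EuclideanSpace ℝ ι)
    (hu : (α - 1) * (t ^ 2 * ‖u‖ ^ 2) < 1) :
    ∫⁻ x, (∫⁻ z, ENNReal.ofReal
        (Real.exp (⟪x, w + (t * z) • u⟫ - ‖w + (t * z) • u‖ ^ 2 / 2)) ∂gaussianReal 0 1) ^ α
        ∂stdGaussian (EuclideanSpace ℝ ι) ≤
      ENNReal.ofReal (Real.exp ((α - 1) * ((t ^ 2 * ‖u‖ ^ 2 + α * ‖w‖ ^ 2) /
        (1 - (α - 1) * (t ^ 2 * ‖u‖ ^ 2)) / 2))) := by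
  have hα0 : 0 < α := by linarith
  set a := t ^ 2 * ‖u‖ ^ 2 with ha
  have ha0 : 0 ≤ a := by positivity
  have ha1 : 0 < 1 + a := by linarith
  set k := α / (1 + a) with hk
  have hk0 : 0 < k := by positivity
  have hx : 0 < 1 - (α - 1) * a := by linarith
  have hka : 1 + -(k * a) = (1 - (α - 1) * a) / (1 + a) := by
    rw [hk]; field_simp; ring
  have hka0 : -1 < -(k * a) := by
    have : 0 < 1 + -(k * a) := by rw [hka]; positivity
    linarith
  -- the square in the exponent is linearized by one more standard Gaussian variable
  have h1 : ∀ x, (∫⁻ z, ENNReal.ofReal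
        (Real.exp (⟪x, w + (t * z) • u⟫ - ‖w + (t * z) • u‖ ^ 2 / 2)) ∂gaussianReal 0 1) ^ α =
      ENNReal.ofReal ((√(1 + a))⁻¹ ^ α) * ∫⁻ z, ENNReal.ofReal (Real.exp
        (⟪x, α • w + (√k * t * z) • u⟫ - (α * ‖w‖ ^ 2 / 2 + √k * t * z * ⟪w, u⟫)))
        ∂gaussianReal 0 1 := by
    intro x
    have h2 : ∀ z, ENNReal.ofReal (Real.exp
        (⟪x, α • w + (√k * t * z) • u⟫ - (α * ‖w‖ ^ 2 / 2 + √k * t * z * ⟪w, u⟫))) =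
        ENNReal.ofReal (Real.exp (α * (⟪x, w⟫ - ‖w‖ ^ 2 / 2))) *
        ENNReal.ofReal (Real.exp ((√k * (t * ⟪x - w, u⟫)) * z - 0 * z ^ 2 / 2)) := by
      intro z
      rw [← ENNReal.ofReal_mul (Real.exp_pos _).le, ← Real.exp_add]
      congr 2
      rw [inner_add_right, inner_smul_right, inner_smul_right, inner_sub_left]
      ring
    rw [lintegral_congr h2, lintegral_const_mul _ (by fun_prop),
      lintegral_exp_quadratic_gaussianReal (by norm_num), lintegral_exp_affine_gaussianReal,
      ← ENNReal.ofReal_mul (Real.exp_pos _).le, ← ENNReal.ofReal_mul (by positivity),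
      ENNReal.ofReal_rpow_of_pos (by positivity), ← ha]
    congr 1
    rw [Real.mul_rpow (by positivity) (by positivity), Real.mul_rpow (by positivity) (by positivity),
      ← Real.exp_mul, ← Real.exp_mul, mul_pow √k, Real.sq_sqrt hk0.le]
    simp only [add_zero, Real.sqrt_one, inv_one, one_mul, mul_one]
    rw [show (t * ⟪x - w, u⟫) ^ 2 / (2 * (1 + a)) * α = k * (t * ⟪x - w, u⟫) ^ 2 / 2 by
      rw [hk]; field_simp]
    rw [mul_comm α]
    ring
  rw [lintegral_congr h1, lintegral_const_mul _ (by fun_prop), lintegral_lintegral_swap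
    (Measurable.aemeasurable (by fun_prop))]
  have h3 : ∀ z : ℝ, ∫⁻ x, ENNReal.ofReal (Real.exp
        (⟪x, α • w + (√k * t * z) • u⟫ - (α * ‖w‖ ^ 2 / 2 + √k * t * z * ⟪w, u⟫)))
        ∂stdGaussian (EuclideanSpace ℝ ι) =
      ENNReal.ofReal (Real.exp (α * (α - 1) * ‖w‖ ^ 2 / 2)) *
      ENNReal.ofReal (Real.exp (((α - 1) * √k * t * ⟪w, u⟫) * z - (-(k * a)) * z ^ 2 / 2)) := by
    intro z
    have h4 : ∀ x, ENNReal.ofReal (Real.exp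
        (⟪x, α • w + (√k * t * z) • u⟫ - (α * ‖w‖ ^ 2 / 2 + √k * t * z * ⟪w, u⟫))) =
        ENNReal.ofReal (Real.exp (-(α * ‖w‖ ^ 2 / 2 + √k * t * z * ⟪w, u⟫))) *
        ENNReal.ofReal (Real.exp ⟪x, α • w + (√k * t * z) • u⟫) := by
      intro x
      rw [← ENNReal.ofReal_mul (Real.exp_pos _).le, ← Real.exp_add]
      congr 2
      ring
    rw [lintegral_congr h4, lintegral_const_mul _ (by fun_prop), lintegral_exp_inner_stdGaussian,
      ← ENNReal.ofReal_mul (Real.exp_pos _).le, ← ENNReal.ofReal_mul (Real.exp_pos _).le,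
      ← Real.exp_add, ← Real.exp_add]
    congr 2
    rw [norm_add_sq_real, inner_smul_left, inner_smul_right, norm_smul, norm_smul, mul_pow, mul_pow,
      Real.norm_eq_abs, Real.norm_eq_abs, sq_abs, sq_abs, mul_pow, mul_pow, Real.sq_sqrt hk0.le, ha]
    simp only [conj_trivial]
    ring
  rw [lintegral_congr h3, lintegral_const_mul _ (by fun_prop),
    lintegral_exp_quadratic_gaussianReal hka0, ← ENNReal.ofReal_mul (Real.exp_pos _).le,
    ← ENNReal.ofReal_mul (by positivity)]
  refine ENNReal.ofReal_le_ofReal ?_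
  -- weakening `(1 + a) ^ (-α / 2)` to `(1 + a) ^ (-1 / 2)` leaves what cancels against the
  -- determinant factor of the last Gaussian integral
  have hpre : (√(1 + a))⁻¹ ^ α ≤ (√(1 + a))⁻¹ := by
    refine Real.rpow_le_self_of_le_one (by positivity) ?_ hα.le
    exact inv_le_one_of_one_le₀ (Real.one_le_sqrt.2 (by linarith))
  have hdet : (√(1 + a))⁻¹ * (√(1 + -(k * a)))⁻¹ = (√(1 - (α - 1) * a))⁻¹ := by
    rw [hka, Real.sqrt_div hx.le]
    have : √(1 + a) ≠ 0 := (Real.sqrt_pos.2 ha1).ne'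
    field_simp
  have hcs : (t * ⟪w, u⟫) ^ 2 ≤ ‖w‖ ^ 2 * a := by
    have := real_inner_mul_inner_self_le w u
    rw [real_inner_self_eq_norm_sq, real_inner_self_eq_norm_sq] at this
    rw [ha, mul_pow]
    nlinarith [mul_le_mul_of_nonneg_left this (sq_nonneg t)]
  have hexp : α * (α - 1) * ‖w‖ ^ 2 / 2 +
      ((α - 1) * √k * t * ⟪w, u⟫) ^ 2 / (2 * (1 + -(k * a))) ≤
      (α - 1) * (α * ‖w‖ ^ 2 / (1 - (α - 1) * a) / 2) := by
    have e1 : ((α - 1) * √k * t * ⟪w, u⟫) ^ 2 / (2 * (1 + -(k * a))) =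
        (α - 1) ^ 2 * α / (2 * (1 - (α - 1) * a)) * (t * ⟪w, u⟫) ^ 2 := by
      rw [hka, show (α - 1) * √k * t * ⟪w, u⟫ = (α - 1) * √k * (t * ⟪w, u⟫) by ring, mul_pow,
        mul_pow, Real.sq_sqrt hk0.le, hk]
      field_simp
    rw [e1]
    calc _ ≤ α * (α - 1) * ‖w‖ ^ 2 / 2 +
        (α - 1) ^ 2 * α / (2 * (1 - (α - 1) * a)) * (‖w‖ ^ 2 * a) := by gcongr
      _ = _ := by field_simp; ring
  calc (√(1 + a))⁻¹ ^ α * (Real.exp (α * (α - 1) * ‖w‖ ^ 2 / 2) * ((√(1 + -(k * a)))⁻¹ *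
        Real.exp (((α - 1) * √k * t * ⟪w, u⟫) ^ 2 / (2 * (1 + -(k * a))))))
      = (√(1 + a))⁻¹ ^ α * ((√(1 + -(k * a)))⁻¹ * Real.exp (α * (α - 1) * ‖w‖ ^ 2 / 2 +
        ((α - 1) * √k * t * ⟪w, u⟫) ^ 2 / (2 * (1 + -(k * a))))) := by
        rw [Real.exp_add]; ring
    _ ≤ (√(1 + a))⁻¹ * ((√(1 + -(k * a)))⁻¹ *
        Real.exp ((α - 1) * (α * ‖w‖ ^ 2 / (1 - (α - 1) * a) / 2))) := by gcongr
    _ = (√(1 - (α - 1) * a))⁻¹ *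
        Real.exp ((α - 1) * (α * ‖w‖ ^ 2 / (1 - (α - 1) * a) / 2)) := by
        rw [← mul_assoc, hdet]
    _ ≤ Real.exp ((α - 1) * a / (1 - (α - 1) * a) / 2) *
        Real.exp ((α - 1) * (α * ‖w‖ ^ 2 / (1 - (α - 1) * a) / 2)) := by
        gcongr
        exact inv_sqrt_one_sub_le hu
    _ = _ := by
        rw [← Real.exp_add]
        congr 1
        field_simp

/-- The Rényi bound between the laws of `η + (s + t ζ) u` and `η + (s + t ζ) v`, for `η` a standard
Gaussian vector and `ζ` an independent standard Gaussian variable. -/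
theorem renyiPowerLE_stdGaussian_prod {α : ℝ} (hα : 1 < α) (s t : ℝ) (u v : EuclideanSpace ℝ ι)
    (hu : (α - 1) * (t ^ 2 * ‖u‖ ^ 2) < 1) :
    RenyiPowerLE α
      (ENNReal.ofReal (Real.exp ((α - 1) * ((t ^ 2 * ‖v‖ ^ 2 + (t ^ 2 * ‖u‖ ^ 2 +
        α * (s ^ 2 * ‖u - v‖ ^ 2)) / (1 - (α - 1) * (t ^ 2 * ‖u‖ ^ 2))) / 2))))
      (((stdGaussian (EuclideanSpace ℝ ι)).prod (gaussianReal 0 1)).map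
        (fun p => p.1 + (s + t * p.2) • u))
      (((stdGaussian (EuclideanSpace ℝ ι)).prod (gaussianReal 0 1)).map
        (fun p => p.1 + (s + t * p.2) • v)) := by
  set w := s • (u - v) with hw
  have hw2 : ‖w‖ ^ 2 = s ^ 2 * ‖u - v‖ ^ 2 := by
    rw [hw, norm_smul, mul_pow, Real.norm_eq_abs, sq_abs]
  -- after translation by `- s • v` the second law has mean zero
  have h1 := RenyiPowerLE.of_withDensity (Q := stdGaussian (EuclideanSpace ℝ ι)) hα
    (p := fun x => ∫⁻ z, ENNReal.ofReal
        (Real.exp (⟪x, w + (t * z) • u⟫ - ‖w + (t * z) • u‖ ^ 2 / 2)) ∂gaussianReal 0 1)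
    (by fun_prop)
  rw [← map_add_stdGaussian_prod (gaussianReal 0 1) (H := fun z => w + (t * z) • u)
    (by fun_prop)] at h1
  have h2 := ((h1.mono_const hα (lintegral_density_rpow_le hα t w u hu)).of_smul_le hα
    (ENNReal.ofReal_pos.2 (Real.exp_pos _)).ne' ENNReal.ofReal_ne_top
    (smul_stdGaussian_le_map t v)).map (f := fun x => x + s • v) (by fun_prop)
  rw [Measure.map_map (by fun_prop) (by fun_prop), Measure.map_map (by fun_prop) (by fun_prop)] at h2
  have e1 : (fun x => x + s • v) ∘ (fun p : EuclideanSpace ℝ ι × ℝ => p.1 + (w + (t * p.2) • u)) =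
      fun p => p.1 + (s + t * p.2) • u := by
    funext p
    simp only [Function.comp, hw, smul_sub, add_smul]
    abel
  have e2 : (fun x => x + s • v) ∘ (fun p : EuclideanSpace ℝ ι × ℝ => p.1 + (t * p.2) • v) =
      fun p => p.1 + (s + t * p.2) • v := by
    funext p
    simp only [Function.comp, add_smul]
    abel
  rw [e1, e2] at h2
  refine h2.mono_const hα (le_of_eq ?_)
  rw [← ENNReal.ofReal_inv_of_pos (Real.exp_pos _), ← Real.exp_neg,
    ENNReal.ofReal_rpow_of_pos (Real.exp_pos _), ← ENNReal.ofReal_mul (by positivity),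
    ← Real.exp_mul, ← Real.exp_add, hw2]
  congr 2
  ring

end Gaussian

/-! ### Aggregated noise -/

/-- If `A` is bounded below by `√M`, then `A†` has the right inverse `A (A† A)⁻¹`, of norm at most
`1 / √M`. -/
theorem LinearMap.exists_rightInverse_adjoint {E F : Type*} [NormedAddCommGroup E]
    [InnerProductSpace ℝ E] [FiniteDimensional ℝ E] [NormedAddCommGroup F]
    [InnerProductSpace ℝ F] [FiniteDimensional ℝ F] (A : F →ₗ[ℝ] E) {M : ℝ} (hM : 0 < M)
    (hA : ∀ y, M * ‖y‖ ^ 2 ≤ ‖A y‖ ^ 2) :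
    ∃ R : F →ₗ[ℝ] E, (∀ y, A.adjoint (R y) = y) ∧ ∀ y, M * ‖R y‖ ^ 2 ≤ ‖y‖ ^ 2 := by
  have hinj : Function.Injective (A.adjoint ∘ₗ A) := by
    refine (injective_iff_map_eq_zero _).2 fun y hy => ?_
    have h1 : ‖A y‖ ^ 2 = 0 := by
      rw [← real_inner_self_eq_norm_sq, ← LinearMap.adjoint_inner_right,
        ← LinearMap.comp_apply, hy, inner_zero_right]
    have h2 : ‖y‖ ^ 2 ≤ 0 := by
      have := hA y
      rw [h1] at this
      exact nonpos_of_mul_nonpos_right this hM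
    exact norm_eq_zero.1 (pow_eq_zero_iff two_ne_zero |>.1 (le_antisymm h2 (sq_nonneg _)))
  set e := LinearEquiv.ofInjectiveEndo _ hinj with he
  have hR : ∀ y, A.adjoint (A (e.symm y)) = y := fun y => e.apply_symm_apply y
  refine ⟨A ∘ₗ e.symm.toLinearMap, hR, fun y => ?_⟩
  set w := e.symm y with hw
  have h1 : ‖A w‖ ^ 2 = ⟪w, y⟫ := by
    rw [← real_inner_self_eq_norm_sq, ← LinearMap.adjoint_inner_right, hR]
  have h2 : ‖A w‖ ^ 2 ≤ ‖w‖ * ‖y‖ := h1 ▸ real_inner_le_norm w y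
  have h3 := hA w
  change M * ‖A w‖ ^ 2 ≤ ‖y‖ ^ 2
  rcases (sq_nonneg ‖A w‖).eq_or_lt' with h0 | h0
  · rw [h0, mul_zero]; positivity
  · refine le_of_mul_le_mul_right ?_ h0
    calc M * ‖A w‖ ^ 2 * ‖A w‖ ^ 2 = M * (‖A w‖ ^ 2) ^ 2 := by ring
      _ ≤ M * (‖w‖ * ‖y‖) ^ 2 := by gcongr
      _ = M * ‖w‖ ^ 2 * ‖y‖ ^ 2 := by ring
      _ ≤ ‖A w‖ ^ 2 * ‖y‖ ^ 2 := by gcongr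
      _ = _ := by ring

section Aggregate

variable {ι : Type*} [Fintype ι] {F : Type*} [NormedAddCommGroup F] [InnerProductSpace ℝ F]
  [MeasurableSpace F] [BorelSpace F] [SecondCountableTopology F]

theorem charFun_map_sum_stdGaussian (s t : ℝ) (a : ι → F) (τ : F) :
    charFun ((stdGaussian (EuclideanSpace ℝ ι)).map fun e => ∑ q, (s + t * e q) • a q) τ =
      ∏ q, charFun ((gaussianReal 0 1).map fun z => (s + t * z) • a q) τ := by
  have hp : ∀ q, IsProbabilityMeasure ((gaussianReal 0 1).map fun z => (s + t * z) • a q) :=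
    fun q => Measure.isProbabilityMeasure_map (by fun_prop)
  rw [← Finset.prod_apply, ← charFun_map_sum_pi_eq_prod
      (μ := fun q => (gaussianReal 0 1).map fun z => (s + t * z) • a q),
    ← map_pi_eq_stdGaussian, Measure.map_map (by fun_prop) (by fun_prop),
    ← Measure.pi_map_pi (f := fun q z => (s + t * z) • a q) (μ := fun _ => gaussianReal 0 1)
      (fun q => by fun_prop), Measure.map_map (by fun_prop) (by fun_prop)]
  congr 2

/-- The noise coordinate of the index `q₀` splits off from the aggregate as an independent standard
Gaussian variable. -/
theorem map_sum_noise_eq [CompleteSpace F] {J κ Ω : Type*} [Fintype J] [Fintype κ] [DecidableEq J]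
    [DecidableEq κ]
    [MeasurableSpace Ω] {P : Measure Ω} [IsProbabilityMeasure P] {ξ : J → Ω → EuclideanSpace ℝ κ}
    (hξ : ∀ j, HasLaw (ξ j) (stdGaussian (EuclideanSpace ℝ κ)) P) (hind : iIndepFun ξ P)
    (s t : ℝ) (a : J × κ → F) (q₀ : J × κ) :
    P.map (fun ω => ∑ j, ∑ k, (s + t * ξ j ω k) • a (j, k)) =
      ((stdGaussian (EuclideanSpace ℝ {q // q ≠ q₀})).prod (gaussianReal 0 1)).map
        (fun p => (∑ q : {q // q ≠ q₀}, (s + t * p.1 q) • a q) + (s + t * p.2) • a q₀) := by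
  have hmeas : ∀ j, Measurable fun e : EuclideanSpace ℝ κ => ∑ k, (s + t * e k) • a (j, k) :=
    fun j => by fun_prop
  have hae : ∀ j, AEMeasurable (fun ω => ∑ k, (s + t * ξ j ω k) • a (j, k)) P :=
    fun j => (hmeas j).comp_aemeasurable (hξ j).aemeasurable
  have hind' : iIndepFun (fun j ω => ∑ k, (s + t * ξ j ω k) • a (j, k)) P :=
    hind.comp (fun j e => ∑ k, (s + t * e k) • a (j, k)) hmeas
  have hp1 : IsProbabilityMeasure (P.map (fun ω => ∑ j, ∑ k, (s + t * ξ j ω k) • a (j, k))) :=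
    Measure.isProbabilityMeasure_map (Finset.aemeasurable_fun_sum _ fun j _ => hae j)
  have hp2 : IsProbabilityMeasure
      (((stdGaussian (EuclideanSpace ℝ {q // q ≠ q₀})).prod (gaussianReal 0 1)).map
        (fun p => (∑ q : {q // q ≠ q₀}, (s + t * p.1 q) • a q) + (s + t * p.2) • a q₀)) :=
    Measure.isProbabilityMeasure_map (by fun_prop)
  refine Measure.ext_of_charFun ?_
  ext τ
  have h1 : ∀ j, charFun (P.map fun ω => ∑ k, (s + t * ξ j ω k) • a (j, k)) τ =
      ∏ k, charFun ((gaussianReal 0 1).map fun z => (s + t * z) • a (j, k)) τ := by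
    intro j
    rw [← charFun_map_sum_stdGaussian, ← (hξ j).map_eq,
      AEMeasurable.map_map_of_aemeasurable (hmeas j).aemeasurable (hξ j).aemeasurable]
    rfl
  have hconv : ((stdGaussian (EuclideanSpace ℝ {q // q ≠ q₀})).prod (gaussianReal 0 1)).map
        (fun p => (∑ q : {q // q ≠ q₀}, (s + t * p.1 q) • a q) + (s + t * p.2) • a q₀) =
      ((stdGaussian (EuclideanSpace ℝ {q // q ≠ q₀})).map
          fun e => ∑ q : {q // q ≠ q₀}, (s + t * e q) • a q) ∗
        ((gaussianReal 0 1).map fun z => (s + t * z) • a q₀) := by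
    rw [Measure.conv, Measure.map_prod_map _ _ (by fun_prop) (by fun_prop),
      Measure.map_map (by fun_prop) (by fun_prop)]
    rfl
  rw [hind'.charFun_map_fun_sum_eq_prod hae, Finset.prod_apply, Finset.prod_congr rfl
    fun j _ => h1 j, ← Fintype.prod_prod_type'
      (f := fun j k => charFun ((gaussianReal 0 1).map fun z => (s + t * z) • a (j, k)) τ),
    hconv, charFun_conv, charFun_map_sum_stdGaussian, mul_comm]
  exact Fintype.prod_eq_mul_prod_subtype_ne
    (fun q => charFun ((gaussianReal 0 1).map fun z => (s + t * z) • a q) τ) q₀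

/-- Here `a` and `b` stand for `t² ‖U‖²` and `t² ‖V‖²` and `r` for `‖U - V‖²`, where `U` and `V` are
the lifts to noise space of two vectors of norm at most `C`, and `β = 1 / t²`. -/
theorem renyi_exponent_le {α s β C m a b r : ℝ} (hα : 1 < α) (hm : (α - 1) * C ^ 2 < m)
    (ha : a * m ≤ C ^ 2) (hb : b * m ≤ C ^ 2) (hr0 : 0 ≤ r)
    (hr : r * m ≤ 4 * C ^ 2 * β) :
    (b + (a + α * (s ^ 2 * r)) / (1 - (α - 1) * a)) / 2 ≤
      (C ^ 2 + 2 * α * s ^ 2 * C ^ 2 * β) / (m - (α - 1) * C ^ 2) := by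
  set n := m - (α - 1) * C ^ 2 with hn
  have hα1 : 0 < α - 1 := by linarith
  have hn0 : 0 < n := by linarith
  have hm0 : 0 < m := lt_of_le_of_lt (by positivity) hm
  have hx : 0 < 1 - (α - 1) * a := by
    have : 0 < (1 - (α - 1) * a) * m := by nlinarith
    exact (pos_iff_pos_of_mul_pos this).2 hm0
  have hinv : n ≤ (1 - (α - 1) * a) * m := by nlinarith
  have h1 : b ≤ C ^ 2 / n := by
    have : b ≤ C ^ 2 / m := (le_div_iff₀ hm0).2 hb
    refine this.trans ?_
    gcongr
    nlinarith [mul_nonneg hα1.le (sq_nonneg C)]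
  have h2 : a / (1 - (α - 1) * a) ≤ C ^ 2 / n := by
    rw [div_le_div_iff₀ hx hn0]
    nlinarith
  have h3 : r / (1 - (α - 1) * a) ≤ 4 * C ^ 2 * β / n := by
    rw [div_le_div_iff₀ hx hn0]
    calc r * n ≤ r * ((1 - (α - 1) * a) * m) := by gcongr
      _ = r * m * (1 - (α - 1) * a) := by ring
      _ ≤ _ := by gcongr
  calc _ = (b + a / (1 - (α - 1) * a) + α * s ^ 2 * (r / (1 - (α - 1) * a))) / 2 := by ring
    _ ≤ (C ^ 2 / n + C ^ 2 / n + α * s ^ 2 * (4 * C ^ 2 * β / n)) / 2 := by gcongr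
    _ = _ := by ring

/-- The Rényi bound between two aggregates that differ in the vector of one noise coordinate, when the
other vectors `a q` satisfy `∑ a q (a q)ᵀ ≥ m`. -/
theorem renyiPowerLE_aggregate {F' : Type*} [NormedAddCommGroup F'] [InnerProductSpace ℝ F']
    [FiniteDimensional ℝ F'] (J : F' →ₗ[ℝ] F) (a : ι → F') (u v : F') {α C m s t : ℝ} (hα : 1 < α)
    (ht : t ≠ 0) (hm : (α - 1) * C ^ 2 < m)
    (ha : ∀ y, m * ‖y‖ ^ 2 ≤ ∑ q, ⟪a q, y⟫ ^ 2) (hu : ‖u‖ ≤ C) (hv : ‖v‖ ≤ C) :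
    RenyiPowerLE α
      (ENNReal.ofReal (Real.exp ((α - 1) *
        ((C ^ 2 + 2 * α * s ^ 2 * C ^ 2 * (1 / t ^ 2)) / (m - (α - 1) * C ^ 2)))))
      (((stdGaussian (EuclideanSpace ℝ ι)).prod (gaussianReal 0 1)).map
        (fun p => (∑ q, (s + t * p.1 q) • J (a q)) + (s + t * p.2) • J u))
      (((stdGaussian (EuclideanSpace ℝ ι)).prod (gaussianReal 0 1)).map
        (fun p => (∑ q, (s + t * p.1 q) • J (a q)) + (s + t * p.2) • J v)) := by
  have hα1 : 0 < α - 1 := by linarith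
  have hm0 : 0 < m := lt_of_le_of_lt (by positivity) hm
  have ht2 : 0 < t ^ 2 := by positivity
  have hC : 0 ≤ C := (norm_nonneg u).trans hu
  -- `A` is the adjoint of the linear part `e ↦ ∑ q, (t * e q) • a q` of the aggregate, before `J`
  let A : F' →ₗ[ℝ] EuclideanSpace ℝ ι :=
    { toFun := fun y => WithLp.toLp 2 fun q => t * ⟪a q, y⟫
      map_add' := fun x y => by ext q; simp [inner_add_right, mul_add]
      map_smul' := fun c x => by ext q; simp [inner_smul_right]; ring }
  have hA : ∀ y, t ^ 2 * m * ‖y‖ ^ 2 ≤ ‖A y‖ ^ 2 := by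
    intro y
    rw [EuclideanSpace.real_norm_sq_eq, mul_assoc]
    simp only [A, LinearMap.coe_mk, AddHom.coe_mk, mul_pow, ← Finset.mul_sum]
    gcongr
    exact ha y
  obtain ⟨R, hR, hRn⟩ := A.exists_rightInverse_adjoint (mul_pos ht2 hm0) hA
  have hadj : ∀ e, A.adjoint e = ∑ q, (t * e q) • a q := by
    intro e
    refine ext_inner_right ℝ fun y => ?_
    rw [LinearMap.adjoint_inner_left, PiLp.inner_apply, sum_inner]
    refine Finset.sum_congr rfl fun q _ => ?_
    simp only [A, LinearMap.coe_mk, AddHom.coe_mk, inner_smul_left, conj_trivial, RCLike.inner_apply]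
    ring
  -- the affine map `Θ` sends the shift along `R y` to the shift along `J y`
  set Θ : EuclideanSpace ℝ ι → F := fun e => ∑ q, (s + t * e q) • J (a q) with hΘ
  have hΘm : Measurable Θ := by fun_prop
  have hshift : ∀ (y : F') (e : EuclideanSpace ℝ ι) (c : ℝ), Θ (e + c • R y) = Θ e + c • J y := by
    intro y e c
    conv_rhs => rw [← hR y, hadj, map_sum, Finset.smul_sum]
    simp only [hΘ]
    rw [← Finset.sum_add_distrib]
    refine Finset.sum_congr rfl fun q _ => ?_
    rw [map_smul, smul_smul, ← add_smul]
    congr 1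
    simp only [PiLp.add_apply, PiLp.smul_apply, smul_eq_mul]
    ring
  have hnorm : ∀ y, t ^ 2 * ‖R y‖ ^ 2 * m ≤ ‖y‖ ^ 2 := fun y => by linarith [hRn y]
  have hsq : ∀ y : F', ‖y‖ ≤ C → ‖y‖ ^ 2 ≤ C ^ 2 := fun y hy => by gcongr
  have hua := (hnorm u).trans (hsq u hu)
  have hvb := (hnorm v).trans (hsq v hv)
  have huv : ‖R u - R v‖ ^ 2 * m ≤ 4 * C ^ 2 * (1 / t ^ 2) := by
    have h1 := hnorm (u - v)
    rw [map_sub] at h1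
    have h2 : ‖u - v‖ ≤ 2 * C := (norm_sub_le u v).trans (by linarith)
    have h3 : ‖u - v‖ ^ 2 ≤ (2 * C) ^ 2 := by gcongr
    rw [mul_one_div, le_div_iff₀ ht2]
    linarith
  have hlt : (α - 1) * (t ^ 2 * ‖R u‖ ^ 2) < 1 := by
    by_contra! hge
    nlinarith
  have key := (renyiPowerLE_stdGaussian_prod hα s t (R u) (R v) hlt).map hΘm
  rw [Measure.map_map hΘm (by fun_prop), Measure.map_map hΘm (by fun_prop)] at key
  have e1 : ∀ y, Θ ∘ (fun p : EuclideanSpace ℝ ι × ℝ => p.1 + (s + t * p.2) • R y) =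
      fun p => Θ p.1 + (s + t * p.2) • J y := fun y => by
    funext p
    exact hshift y p.1 _
  rw [e1, e1] at key
  refine key.mono_const hα (ENNReal.ofReal_le_ofReal (Real.exp_le_exp.2 ?_))
  exact mul_le_mul_of_nonneg_left
    (renyi_exponent_le hα hm hua hvb (sq_nonneg _) huv) hα1.le

end Aggregate

/-! ### Clipped gradients and projected covariances -/

theorem norm_clip_le {K : ℕ} {C : ℝ} (hC : 0 < C) (x : EuclideanSpace ℝ (Fin K)) :
    ‖FedSA.clip C x‖ ≤ C := by
  have hmax : 0 < max ‖x‖ C := lt_max_of_lt_right hC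
  rw [FedSA.clip, norm_smul, Real.norm_of_nonneg (by positivity), div_mul_eq_mul_div,
    div_le_iff₀ hmax]
  gcongr
  exact le_max_left _ _

theorem FedSA.MinEigenvalueGE.le_dotProduct {n : ℕ} {A : Matrix (Fin n) (Fin n) ℝ} {l : ℝ}
    (hA : A.IsHermitian) (h : FedSA.MinEigenvalueGE A l) (y : Fin n → ℝ) :
    l * (y ⬝ᵥ y) ≤ y ⬝ᵥ A.mulVec y := by
  have hB : (A - l • (1 : Matrix (Fin n) (Fin n) ℝ)).IsHermitian :=
    hA.sub (by simp [Matrix.IsHermitian])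
  have hpsd : (A - l • (1 : Matrix (Fin n) (Fin n) ℝ)).PosSemidef := by
    refine hB.posSemidef_iff_eigenvalues_nonneg.2 fun i => ?_
    have hv := hB.mulVec_eigenvectorBasis i
    have hev : Module.End.HasEigenvalue (Matrix.toLin' A) (hB.eigenvalues i + l) := by
      refine Module.End.hasEigenvalue_of_hasEigenvector
        (x := (hB.eigenvectorBasis i).ofLp) ⟨?_, ?_⟩
      · rw [Module.End.mem_eigenspace_iff, Matrix.toLin'_apply]
        rw [Matrix.sub_mulVec, Matrix.smul_mulVec, Matrix.one_mulVec, sub_eq_iff_eq_add] at hv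
        rw [hv, add_smul]
      · intro h0
        exact hB.eigenvectorBasis.orthonormal.ne_zero i (by ext j; exact congrFun h0 j)
    have := h _ hev
    simp only [Pi.zero_apply]
    linarith
  have h1 := hpsd.dotProduct_mulVec_nonneg y
  rw [Matrix.sub_mulVec, Matrix.smul_mulVec, Matrix.one_mulVec, dotProduct_sub, dotProduct_smul,
    star_trivial, smul_eq_mul] at h1
  linarith

theorem mul_normSq_le_sum_inner_sq {Ks D : ℕ} (hD : 0 < D) {Z : Type*} (gs : Z → Fin Ks → ℝ)
    (d : Fin D → Z) {l : ℝ} (h : FedSA.MinEigenvalueGE (FedSA.projCov gs d) l)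
    (y : EuclideanSpace ℝ (Fin Ks)) :
    D * l * ‖y‖ ^ 2 ≤ ∑ k, ⟪WithLp.toLp 2 (gs (d k)), y⟫ ^ 2 := by
  have hherm : (FedSA.projCov gs d).IsHermitian := by
    rw [Matrix.IsHermitian, Matrix.conjTranspose_eq_transpose_of_trivial, FedSA.projCov,
      Matrix.transpose_smul, Matrix.transpose_sum]
    simp [Matrix.transpose_vecMulVec]
  have h1 := h.le_dotProduct hherm y.ofLp
  have hD0 : (0 : ℝ) < D := by exact_mod_cast hD
  have h2 : y.ofLp ⬝ᵥ (FedSA.projCov gs d).mulVec y.ofLp =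
      (1 / (D : ℝ)) * ∑ k, ⟪WithLp.toLp 2 (gs (d k)), y⟫ ^ 2 := by
    rw [FedSA.projCov, Matrix.smul_mulVec, dotProduct_smul, smul_eq_mul, Matrix.sum_mulVec,
      dotProduct_sum]
    congr 1
    refine Finset.sum_congr rfl fun k _ => ?_
    rw [Matrix.vecMulVec_mulVec, EuclideanSpace.inner_eq_star_dotProduct]
    simp [dotProduct_smul, dotProduct_comm, sq]
  have h3 : y.ofLp ⬝ᵥ y.ofLp = ‖y‖ ^ 2 := by
    rw [EuclideanSpace.real_norm_sq_eq]; simp [dotProduct, sq]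
  rw [h2, h3, div_mul_eq_mul_div, one_mul, le_div_iff₀ hD0] at h1
  linarith

theorem norm_toEuclideanLin_of_transpose_mul_self {K Ks : ℕ} {S : Matrix (Fin K) (Fin Ks) ℝ}
    (hS : S.transpose * S = 1) (y : EuclideanSpace ℝ (Fin Ks)) :
    ‖S.toEuclideanLin y‖ = ‖y‖ := by
  have h : ‖S.toEuclideanLin y‖ ^ 2 = ‖y‖ ^ 2 := by
    rw [← real_inner_self_eq_norm_sq, ← real_inner_self_eq_norm_sq,
      EuclideanSpace.inner_eq_star_dotProduct, EuclideanSpace.inner_eq_star_dotProduct]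
    simp only [star_trivial, Matrix.ofLp_toLpLin, Matrix.toLin'_apply]
    rw [Matrix.dotProduct_mulVec, Matrix.vecMul_mulVec, ← Matrix.dotProduct_mulVec, hS,
      Matrix.one_mulVec]
  exact (sq_eq_sq₀ (norm_nonneg _) (norm_nonneg _)).1 h

/-! ### Privacy of the aggregate -/

theorem renyiPowerLE_userMechanism
    {N K Ks D : ℕ} (hD : 0 < D) {B C : ℝ} (hB : 0 < B) (hC : 0 < C)
    {Z : Type*} (L : EuclideanSpace ℝ (Fin K) → Z → ℝ) (θ : EuclideanSpace ℝ (Fin K))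
    {Ω : Type*} [MeasurableSpace Ω] (P : Measure Ω) [IsProbabilityMeasure P]
    (ξ : Fin N → Ω → EuclideanSpace ℝ (Fin D))
    (hξ : ∀ j, HasLaw (ξ j) (stdGaussian (EuclideanSpace ℝ (Fin D))) P)
    (hind : iIndepFun ξ P)
    (S : Matrix (Fin K) (Fin Ks) ℝ) (hS : S.transpose * S = 1)
    (gs : Z → Fin Ks → ℝ)
    (hgs : ∀ z, (FedSA.clippedGrad L θ C z).ofLp = S.mulVec (gs z))
    (i : Fin N) (data : Fin N → Fin D → Z) (lam : Fin N → ℝ)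
    (hcov : ∀ j, j ≠ i → FedSA.MinEigenvalueGE (FedSA.projCov gs (data j)) (lam j))
    (α : ℝ) (hα : α ∈ Set.Ioo 1 (D * (∑ j, lam j) / C ^ 2)) {d d' : Fin D → Z}
    (hdd : FedSA.Neighbor gs (lam i) d d') :
    RenyiPowerLE α
      (ENNReal.ofReal (Real.exp ((α - 1) * FedSA.epsStar α B C D (∑ j, lam j))))
      (FedSA.userMechanism P ξ L θ C B data i d) (FedSA.userMechanism P ξ L θ C B data i d') := by
  obtain ⟨⟨k₀, hk₀⟩, hcov'⟩ := hdd
  obtain ⟨hα1, hα2⟩ := hα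
  have hD0 : (0 : ℝ) < D := by exact_mod_cast hD
  set Λ := ∑ j, lam j with hΛ
  have hαΛ : α * C ^ 2 < D * Λ := (lt_div_iff₀ (by positivity)).1 hα2
  set γ : Z → EuclideanSpace ℝ (Fin Ks) := fun z => WithLp.toLp 2 (gs z) with hγ
  have hJ : ∀ z, FedSA.clippedGrad L θ C z = S.toEuclideanLin (γ z) := by
    intro z
    ext q
    rw [hgs]
    simp [γ]
  have hγC : ∀ z, ‖γ z‖ ≤ C := by
    intro z
    rw [← norm_toEuclideanLin_of_transpose_mul_self hS, ← hJ]
    exact norm_clip_le hC _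
  set q₀ : Fin N × Fin D := (i, k₀) with hq₀
  set s : ℝ := 1 / D with hs
  set t : ℝ := 1 / √(B * D) with ht
  have hBD : 0 < B * D := by positivity
  have ht0 : t ≠ 0 := (one_div_pos.2 (Real.sqrt_pos.2 hBD)).ne'
  have ht2 : 1 / t ^ 2 = B * D := by
    rw [ht, div_pow, Real.sq_sqrt hBD.le]; simp
  -- the data points of all users, with dataset `e` for user `i`
  let pt : (Fin D → Z) → Fin N × Fin D → Z := fun e q => Function.update data i e q.1 q.2
  have hpt₀ : ∀ e, pt e q₀ = e k₀ := fun e => by simp [pt, q₀]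
  have hptne : ∀ q : {q // q ≠ q₀}, pt d' q = pt d q := by
    rintro ⟨⟨j, k⟩, hq⟩
    rcases eq_or_ne j i with rfl | hj
    · have hk : k ≠ k₀ := fun h => hq (by rw [h])
      simp [pt, hk₀ k hk]
    · simp [pt, hj]
  have hlaw : ∀ e, FedSA.userMechanism P ξ L θ C B data i e =
      ((stdGaussian (EuclideanSpace ℝ {q // q ≠ q₀})).prod (gaussianReal 0 1)).map
        (fun p => (∑ q : {q // q ≠ q₀}, (s + t * p.1 q) • S.toEuclideanLin (γ (pt e q))) +
          (s + t * p.2) • S.toEuclideanLin (γ (e k₀))) := by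
    intro e
    rw [← hpt₀ e, ← map_sum_noise_eq hξ hind s t (fun q => S.toEuclideanLin (γ (pt e q))) q₀]
    simp only [FedSA.userMechanism, FedSA.aggregateLaw, FedSA.localUpdate, FedSA.samplingWeight, hJ]
    rfl
  have hfull : ∀ e, FedSA.MinEigenvalueGE (FedSA.projCov gs e) (lam i) →
      ∀ y, (D * Λ - C ^ 2) * ‖y‖ ^ 2 ≤ ∑ q : {q // q ≠ q₀}, ⟪γ (pt e q), y⟫ ^ 2 := by
    intro e he y
    have h1 : D * Λ * ‖y‖ ^ 2 ≤ ∑ q, ⟪γ (pt e q), y⟫ ^ 2 := by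
      rw [Fintype.sum_prod_type, hΛ, Finset.mul_sum, Finset.sum_mul]
      refine Finset.sum_le_sum fun j _ => ?_
      rcases eq_or_ne j i with rfl | hj
      · simpa [pt] using mul_normSq_le_sum_inner_sq hD gs e he y
      · simpa [pt, hj] using mul_normSq_le_sum_inner_sq hD gs (data j) (hcov j hj) y
    rw [Fintype.sum_eq_add_sum_subtype_ne _ q₀] at h1
    have h2 : ⟪γ (pt e q₀), y⟫ ^ 2 ≤ C ^ 2 * ‖y‖ ^ 2 := by
      rw [← mul_pow, ← sq_abs]
      gcongr
      exact (abs_real_inner_le_norm _ _).trans (by gcongr; exact hγC _)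
    linarith
  -- the two datasets agree off `q₀`, so it does not matter which of them satisfies the bound
  have hcov_rest : ∀ y, (D * Λ - C ^ 2) * ‖y‖ ^ 2 ≤
      ∑ q : {q // q ≠ q₀}, ⟪γ (pt d q), y⟫ ^ 2 := by
    rcases hcov' with h | h
    · exact hfull d h
    · simpa only [hptne] using hfull d' h
  have key := renyiPowerLE_aggregate S.toEuclideanLin (fun q : {q // q ≠ q₀} => γ (pt d q))
    (γ (d k₀)) (γ (d' k₀)) (s := s) hα1 ht0 (by linarith) hcov_rest (hγC _) (hγC _)
  rw [hlaw, hlaw]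
  simp only [hptne]
  refine key.mono_const hα1 (ENNReal.ofReal_le_ofReal (Real.exp_le_exp.2 ?_))
  refine mul_le_mul_of_nonneg_left ?_ (by linarith)
  have hα1' : 0 < α - 1 := by linarith
  have hn : 0 < D * Λ - α * C ^ 2 := by linarith
  have hone : C ^ 2 ≤ α * C ^ 2 / (α - 1) := by
    rw [le_div_iff₀ hα1']
    nlinarith [sq_nonneg C]
  calc (C ^ 2 + 2 * α * s ^ 2 * C ^ 2 * (1 / t ^ 2)) / (D * Λ - C ^ 2 - (α - 1) * C ^ 2)
      = (C ^ 2 + 2 * α * s ^ 2 * C ^ 2 * (B * D)) / (D * Λ - α * C ^ 2) := by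
        rw [ht2]; congr 1; ring
    _ ≤ (α * C ^ 2 / (α - 1) + 2 * α * s ^ 2 * C ^ 2 * (B * D)) / (D * Λ - α * C ^ 2) := by
        gcongr
    _ = _ := by
        rw [FedSA.epsStar, hs, show Λ - α * C ^ 2 / D = (D * Λ - α * C ^ 2) / D by field_simp]
        field_simp
        ring

theorem theorem3
    {N K Ks D : ℕ} (hD : 0 < D) {B C : ℝ} (hB : 0 < B) (hC : 0 < C)
    -- data points, loss, current model
    {Z : Type*} (L : EuclideanSpace ℝ (Fin K) → Z → ℝ) (θ : EuclideanSpace ℝ (Fin K))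
    (hL : ∀ z, DifferentiableAt ℝ (fun θ' => L θ' z) θ)
    -- independent standard Gaussian sampling noise of the users
    {Ω : Type*} [MeasurableSpace Ω] (P : Measure Ω) [IsProbabilityMeasure P]
    (ξ : Fin N → Ω → EuclideanSpace ℝ (Fin D))
    (hξ : ∀ j, HasLaw (ξ j) (stdGaussian (EuclideanSpace ℝ (Fin D))) P)
    (hind : iIndepFun ξ P)
    -- the clipped gradients lie in the span of the orthonormal columns of `S`
    (S : Matrix (Fin K) (Fin Ks) ℝ) (hS : S.transpose * S = 1)
    (gs : Z → Fin Ks → ℝ)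
    (hgs : ∀ z, (FedSA.clippedGrad L θ C z).ofLp = S.mulVec (gs z))
    -- user `i`, the datasets of the other users, and the eigenvalue bounds
    (i : Fin N) (data : Fin N → Fin D → Z)
    (lam : Fin N → ℝ) (hlam : ∀ j, 0 < lam j)
    (hcov : ∀ j, j ≠ i → FedSA.MinEigenvalueGE (FedSA.projCov gs (data j)) (lam j))
    (hsum : C ^ 2 / D < ∑ j, lam j)
    (α : ℝ) (hα : α ∈ Set.Ioo 1 (D * (∑ j, lam j) / C ^ 2)) :
    FedSA.IsRDP (FedSA.userMechanism P ξ L θ C B data i) (FedSA.Neighbor gs (lam i))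
        α (FedSA.epsStar α B C D (∑ j, lam j)) ∧
      ∀ δ : ℝ, 0 < δ →
        FedSA.IsDP (FedSA.userMechanism P ξ L θ C B data i) (FedSA.Neighbor gs (lam i))
          (FedSA.epsStar α B C D (∑ j, lam j) + Real.log (1 / δ) / (α - 1)) δ := by
  have hmech : ∀ d, IsProbabilityMeasure (FedSA.userMechanism P ξ L θ C B data i d) := by
    intro d
    refine Measure.isProbabilityMeasure_map (Finset.aemeasurable_fun_sum _ fun j _ => ?_)
    have hm : Measurable fun e : EuclideanSpace ℝ (Fin D) =>
        FedSA.localUpdate L θ C B (Function.update data i d j) e := by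
      unfold FedSA.localUpdate FedSA.samplingWeight
      fun_prop
    exact hm.comp_aemeasurable (hξ j).aemeasurable
  have key := fun (d d' : Fin D → Z) (h : FedSA.Neighbor gs (lam i) d d') =>
    renyiPowerLE_userMechanism hD hB hC L θ P ξ hξ hind S hS gs hgs i data lam hcov α hα h
  exact ⟨fun d d' h => (key d d' h).renyiDiv_le hα.1,
    fun δ hδ d d' h A hA => (key d d' h).measure_le_add hα.1 hδ hA⟩
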